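/- Let $(V,\circ,\langle\cdot,\cdot\rangle)$ be a Euclidean Jordan algebra, i.e. a finite-dimensional real inner product space with a commutative bilinear product $\circ$ that has a unit element and satisfies $x\circ(x^2\circ y)=x^2\circ(x\circ y)$ and $\langle x\circ y,z\rangle=\langle y,x\circ z\rangle$ for all $x,y,z\in V$, where $x^2:=x\circ x$. Let $V_+:=\{x^2: x\in V\}$ be its symmetric cone. For $x\in V$ let $x^+$ denote the (metric) projection of $x$ onto $V_+$, for $a\in V_+$ let $\sqrt a$ denote the unique element of $V_+$ whose square is $a$, and for $x,y\in V$ put $x\sqcap y:=x-(x-y)^+$. Then for all $x,y\in V$ and all real $t$ with $0\le t\le 1$, $$t\left[x+y-\sqrt{x^2+y^2}\right]+(1-t)\,(x\sqcap y)=0\iff x\sqcap y=0.$$ -/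

import Mathlib

/-- A Euclidean Jordan algebra: a finite-dimensional real inner product space `V` with a unital,
commutative, bilinear product satisfying the Jordan identity `x ∘ (x² ∘ y) = x² ∘ (x ∘ y)`
(this is `IsCommJordan`) for which the inner product is associative:
`⟪x ∘ y, z⟫ = ⟪y, x ∘ z⟫`. The Jordan product is written `x * y`; it is in general not associative.
Additivity and homogeneity in the second argument follow by commutativity. -/
class EuclideanJordanAlgebra (V : Type*) [NormedAddCommGroup V] [InnerProductSpace ℝ V]
    [FiniteDimensional ℝ V] extends CommMagma V, IsCommJordan V, One V where
  add_mul' : ∀ x y z : V, (x + y) * z = x * z + y * z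
  smul_mul' : ∀ (r : ℝ) (x y : V), (r • x) * y = r • (x * y)
  one_mul' : ∀ x : V, 1 * x = x
  inner_mul' : ∀ x y z : V, inner ℝ (x * y) z = inner ℝ y (x * z)

namespace EuclideanJordanAlgebra

noncomputable section

variable {V : Type*} [NormedAddCommGroup V] [InnerProductSpace ℝ V] [FiniteDimensional ℝ V]
  [EuclideanJordanAlgebra V]

variable (V) in
/-- The (closed) symmetric cone `V₊` of `V`: the set of all squares. -/
def symmetricCone : Set V := {a | ∃ x : V, a = x * x}

/-- `p` is a metric projection of `x` onto `V₊`: a point of `V₊` nearest to `x`. -/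
def IsConeProj (x p : V) : Prop :=
  p ∈ symmetricCone V ∧ ∀ z ∈ symmetricCone V, ‖x - p‖ ≤ ‖x - z‖

/-- `s` is a square root of `a` in the symmetric cone: `s ∈ V₊` and `s² = a`. -/
def IsConeSqrt (a s : V) : Prop :=
  s ∈ symmetricCone V ∧ s * s = a

/-- `x⁺`, the projection of `x` onto `V₊` (which exists and is unique, `V₊` being a nonempty
closed convex cone). -/
def posPart (x : V) : V := Classical.epsilon (IsConeProj x)

/-- `√a`, for `a ∈ V₊` the (unique) element of `V₊` whose square is `a`;
an unspecified value for `a ∉ V₊`. -/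
def sqrt (a : V) : V := Classical.epsilon (IsConeSqrt a)

/-- The min map `x ⊓ y = x - (x - y)⁺`. -/
def minMap (x y : V) : V := x - posPart (x - y)

/-- The Fischer–Burmeister map `x + y - √(x² + y²)`. -/
def fischerBurmeister (x y : V) : V := x + y - sqrt (x * x + y * y)

end

end EuclideanJordanAlgebra

namespace EuclideanJordanAlgebra

noncomputable section

open Polynomial

variable {V : Type*} [NormedAddCommGroup V] [InnerProductSpace ℝ V] [FiniteDimensional ℝ V]
  [EuclideanJordanAlgebra V]

/-! Put A = √(x² + y²) and B = |x - y| = p + q, where x - y = p - q with p, q in the cone and p ∘ q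
= 0. Then 2(x ⊓ y) = x + y - B and 2A² = (x + y)² + B². The equation says (1 + t)(x + y) = 2tA + (1
- t)B; squaring it and eliminating x + y leaves a quadratic in A and B that factors as (A - B) ∘ (αA
+ βB) = 0 with α, β > 0. Positivity forces A = B, hence x + y = B and x ⊓ y = 0. Conversely, x ⊓ y =
0 gives x = p, y = q, so x² + y² = (x + y)².

The Jordan-algebraic input is the spectral decomposition into orthogonal idempotents and
self-duality of the cone, with the fact that orthogonal cone elements have product zero. -/

/-- The nonassociative commutative ring underlying a Euclidean Jordan algebra. -/
abbrev toNonUnitalNonAssocCommRing : NonUnitalNonAssocCommRing V where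
  __ := (inferInstance : AddCommGroup V)
  __ := (inferInstance : CommMagma V)
  left_distrib x y z := by
    rw [mul_comm x, add_mul', mul_comm y, mul_comm z]
  right_distrib := add_mul'
  zero_mul x := by
    have h := smul_mul' (0 : ℝ) (0 : V) x
    rwa [zero_smul, zero_smul] at h
  mul_zero x := by
    have h := smul_mul' (0 : ℝ) (0 : V) x
    rw [zero_smul, zero_smul] at h
    rw [mul_comm, h]

attribute [local instance] toNonUnitalNonAssocCommRing

lemma isScalarTower : IsScalarTower ℝ V V := ⟨smul_mul'⟩

lemma smulCommClass : SMulCommClass ℝ V V :=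
  ⟨fun r x y => by
    change r • (x * y) = x * (r • y)
    rw [mul_comm x (r • y), smul_mul', mul_comm]⟩

attribute [local instance] isScalarTower smulCommClass

lemma mul_one_right (x : V) : x * 1 = x := by rw [mul_comm, one_mul']

/-! ### Power associativity -/

/-- The linearized Jordan identity. -/
lemma linearized_jordan (x y z w : V) :
    (x * y) * (z * w) + (y * z) * (x * w) + (z * x) * (y * w) =
      z * ((x * y) * w) + x * ((y * z) * w) + y * ((z * x) * w) := by
  have h := congrArg (fun f : AddMonoid.End V => f w)
    (two_nsmul_lie_lmul_lmul_add_add_eq_zero x y z)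
  simp only [Ring.lie_def, two_nsmul] at h
  have h' : (2 : ℝ) • ((x * ((y * z) * w) - (y * z) * (x * w)) +
      (y * ((z * x) * w) - (z * x) * (y * w)) +
      (z * ((x * y) * w) - (x * y) * (z * w))) = 0 := by
    rw [two_smul]; exact h
  have h'' := (smul_eq_zero.mp h').resolve_left two_ne_zero
  rw [← sub_eq_zero, ← neg_eq_zero, ← h'']
  abel

/-- Multiplication by `x` as a linear endomorphism. -/
abbrev lmul (x : V) : Module.End ℝ V := LinearMap.mulLeft ℝ x

/-- The linearized Jordan identity read as an operator identity in `y`; it expresses multiplication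
by x^(n+2) through lower powers. -/
lemma lmul_mul_mul (x z w : V) :
    lmul ((z * x) * w) = lmul (z * w) * lmul x + lmul (x * w) * lmul z + lmul (z * x) * lmul w
      - lmul z * lmul w * lmul x - lmul x * lmul w * lmul z := by
  ext v
  have h := linearized_jordan x v z w
  simp only [lmul, LinearMap.sub_apply, LinearMap.add_apply, Module.End.mul_apply,
    LinearMap.mulLeft_apply]
  rw [mul_comm v ((z * x) * w), mul_comm (x * v) w, mul_comm (v * z) w, mul_comm v w,
    mul_comm (x * v), mul_comm (v * z), mul_comm v z] at h
  rw [eq_sub_iff_add_eq, eq_sub_iff_add_eq, h]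
  abel

lemma lmul_isSymmetric (x : V) : (lmul x).IsSymmetric := fun y z => inner_mul' x y z

/-- The elements `p(L_x) 1`, where `L_x` is multiplication by `x`. -/
def polyEval (x : V) (p : ℝ[X]) : V := aeval (lmul x) p 1

lemma polyEval_X_pow_succ (x : V) (n : ℕ) :
    polyEval x (X ^ (n + 1)) = x * polyEval x (X ^ n) := by
  simp [polyEval, pow_succ', Module.End.mul_apply]

lemma commute_lmul_pow (x : V) (n : ℕ) :
    Commute (lmul (polyEval x (X ^ n))) (lmul x) := by
  have h0 : lmul (polyEval x (X ^ 0)) = 1 := by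
    ext v; simp [polyEval, one_mul']
  have h1 : polyEval x (X ^ 1) = x := by simp [polyEval, mul_one_right]
  have hsq : Commute (lmul (x * x)) (lmul x) := by
    ext v
    have h := IsCommJordan.lmul_comm_rmul_rmul x v
    simp only [lmul, Module.End.mul_apply, LinearMap.mulLeft_apply]
    rw [mul_comm (x * x) (x * v), h, mul_comm v]
  induction n using Nat.strong_induction_on with
  | _ n ih =>
    match n with
    | 0 => rw [h0]; exact Commute.one_left _
    | 1 => rw [h1]
    | n + 2 =>
      have e : polyEval x (X ^ (n + 2)) = (polyEval x (X ^ n) * x) * x := by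
        rw [polyEval_X_pow_succ, polyEval_X_pow_succ, mul_comm x (x * _), mul_comm x (polyEval _ _)]
      have e1 : polyEval x (X ^ n) * x = polyEval x (X ^ (n + 1)) := by
        rw [polyEval_X_pow_succ, mul_comm]
      have c0 := ih n (by omega)
      have c1 := ih (n + 1) (by omega)
      have c := Commute.refl (lmul x)
      rw [e, lmul_mul_mul, e1]
      exact ((((c1.mul_left c).add_left (hsq.mul_left c0)).add_left (c1.mul_left c)).sub_left
        ((c0.mul_left c).mul_left c)).sub_left ((c.mul_left c).mul_left c0)

lemma commute_lmul_polyEval (x : V) (p : ℝ[X]) : Commute (lmul (polyEval x p)) (lmul x) := by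
  induction p using Polynomial.induction_on' with
  | add p q hp hq =>
    have : lmul (polyEval x (p + q)) = lmul (polyEval x p) + lmul (polyEval x q) := by
      ext v; simp [polyEval, add_mul]
    rw [this]; exact hp.add_left hq
  | monomial n a =>
    have : lmul (polyEval x (monomial n a)) = a • lmul (polyEval x (X ^ n)) := by
      ext v
      rw [← C_mul_X_pow_eq_monomial]
      simp only [polyEval, map_mul, aeval_C, map_pow, aeval_X, Module.End.mul_apply,
        Module.algebraMap_end_apply, LinearMap.smul_apply, lmul, LinearMap.mulLeft_apply]
      exact smul_mul' _ _ _
    rw [this]; exact (commute_lmul_pow x n).smul_left a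

/-- Power associativity. -/
lemma polyEval_mul (x : V) (p q : ℝ[X]) : polyEval x p * polyEval x q = polyEval x (p * q) := by
  have h : Commute (lmul (polyEval x p)) (aeval (lmul x) q) :=
    Algebra.commute_of_mem_adjoin_singleton_of_commute (R := ℝ)
      (aeval_mem_adjoin_singleton ℝ (lmul x)) (commute_lmul_polyEval x p)
  have h1 := congrArg (fun f : Module.End ℝ V => f 1) h.eq
  simp only [Module.End.mul_apply, lmul, LinearMap.mulLeft_apply, mul_one_right] at h1
  rw [mul_comm p q]
  simpa only [polyEval, map_mul, Module.End.mul_apply] using h1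

/-! ### Spectral decomposition -/

/-- L_x is symmetric, hence diagonalizable, so p(L_x) depends only on the values of p at its
eigenvalues. -/
lemma exists_finset_polyEval_congr (x : V) : ∃ S : Finset ℝ, ∀ p q : ℝ[X],
    (∀ r ∈ S, p.eval r = q.eval r) → polyEval x p = polyEval x q := by
  classical
  have hT := lmul_isSymmetric x
  refine ⟨Finset.univ.image (hT.eigenvalues rfl), fun p q h => ?_⟩
  have : aeval (lmul x) p = aeval (lmul x) q := by
    refine (hT.eigenvectorBasis rfl).toBasis.ext fun i => ?_
    have hv := hT.hasEigenvector_eigenvectorBasis rfl i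
    rw [OrthonormalBasis.coe_toBasis, Module.End.aeval_apply_of_hasEigenvector hv,
      Module.End.aeval_apply_of_hasEigenvector hv]
    congr 1
    exact h _ (Finset.mem_image_of_mem _ (Finset.mem_univ i))
  rw [polyEval, this, polyEval]

/-- `e` is a system of orthogonal idempotents indexed by `S`. -/
structure IsOrthogonalSystem (S : Finset ℝ) (e : ℝ → V) : Prop where
  idem : ∀ r ∈ S, e r * e r = e r
  orthogonal : ∀ r ∈ S, ∀ s ∈ S, r ≠ s → e r * e s = 0

/-- Lagrange basis polynomials on the eigenvalues of L_x, evaluated at x, give the idempotents; some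
of them may vanish. -/
theorem exists_spectral_decomposition (x : V) : ∃ (S : Finset ℝ) (e : ℝ → V),
    IsOrthogonalSystem S e ∧ x = ∑ r ∈ S, r • e r := by
  classical
  obtain ⟨S, hS⟩ := exists_finset_polyEval_congr x
  have hself : ∀ r ∈ S, (Lagrange.basis S id r).eval r = 1 := fun r hr =>
    Lagrange.eval_basis_self (v := id) Function.injective_id.injOn hr
  have hne : ∀ r, ∀ s ∈ S, r ≠ s → (Lagrange.basis S id r).eval s = 0 := fun r s hs h =>
    Lagrange.eval_basis_of_ne (v := id) h hs
  refine ⟨S, fun r => polyEval x (Lagrange.basis S id r), ⟨fun r hr => ?_, fun r hr s hs h => ?_⟩,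
    ?_⟩
  · rw [polyEval_mul]
    refine hS _ _ fun s hs => ?_
    by_cases h : r = s
    · subst h; simp [hself r hr]
    · simp [hne r s hs h]
  · rw [polyEval_mul]
    have h0 : polyEval x 0 = 0 := by simp [polyEval]
    rw [← h0]
    refine hS _ _ fun u hu => ?_
    by_cases h' : r = u
    · subst h'; simp [hne s r hr h.symm]
    · simp [hne r u hu h']
  · have h1 : polyEval x X = x := by simp [polyEval, mul_one_right]
    have h2 : ∑ r ∈ S, r • polyEval x (Lagrange.basis S id r)
        = polyEval x (∑ r ∈ S, r • Lagrange.basis S id r) := by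
      simp [polyEval, map_sum, LinearMap.sum_apply]
    rw [h2]
    nth_rewrite 1 [← h1]
    refine hS _ _ fun s hs => ?_
    rw [eval_X, eval_finsetSum, Finset.sum_eq_single_of_mem s hs]
    · simp [hself s hs]
    · intro r _ h; simp [hne r s hs h]

lemma IsOrthogonalSystem.sum_mul_sum {S : Finset ℝ} {e : ℝ → V} (h : IsOrthogonalSystem S e)
    (f g : ℝ → ℝ) :
    (∑ r ∈ S, f r • e r) * (∑ r ∈ S, g r • e r) = ∑ r ∈ S, (f r * g r) • e r := by
  rw [Finset.sum_mul_sum]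
  refine Finset.sum_congr rfl fun r hr => ?_
  rw [Finset.sum_eq_single_of_mem r hr]
  · rw [smul_mul_smul_comm, h.idem r hr]
  · intro s hs hrs
    rw [smul_mul_smul_comm, h.orthogonal r hr s hs hrs.symm, smul_zero]

lemma IsOrthogonalSystem.sum_mem_symmetricCone {S : Finset ℝ} {e : ℝ → V}
    (h : IsOrthogonalSystem S e) (f : ℝ → ℝ) (hf : ∀ r ∈ S, 0 ≤ f r) :
    ∑ r ∈ S, f r • e r ∈ symmetricCone V := by
  refine ⟨∑ r ∈ S, √(f r) • e r, ?_⟩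
  rw [h.sum_mul_sum]
  exact Finset.sum_congr rfl fun r hr => by rw [Real.mul_self_sqrt (hf r hr)]

/-! ### Positivity of idempotents and of the cone -/

/-- Every eigenvalue of multiplication by an idempotent is `0`, `1/2` or `1`. -/
lemma idempotent_cubic {e : V} (he : e * e = e) (v : V) :
    e * v + (2 : ℝ) • (e * (e * (e * v))) = (3 : ℝ) • (e * (e * v)) := by
  have h := congrArg (fun f : Module.End ℝ V => f v) (lmul_mul_mul e e e)
  simp only [he, lmul, LinearMap.sub_apply, LinearMap.add_apply, Module.End.mul_apply,
    LinearMap.mulLeft_apply] at h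
  nth_rewrite 1 [h]
  module

/-- On the Peirce eigenvalues λ = 0, 1/2, 1 of L_e one has λ = (2λ² - λ)² + 8(λ - λ²)². -/
lemma inner_idempotent_mul_self {e : V} (he : e * e = e) (v : V) :
    inner ℝ (e * v) v = ‖(2 : ℝ) • (e * (e * v)) - e * v‖ ^ 2
      + 8 * ‖e * v - e * (e * v)‖ ^ 2 := by
  have hc := idempotent_cubic he v
  have hs : ∀ a b : V, inner ℝ (e * a) b = inner ℝ a (e * b) := fun a b => inner_mul' e a b
  have c4 : (2 : ℝ) • (e * (e * (e * (e * v)))) = (3 : ℝ) • (e * (e * (e * v))) - e * (e * v) := by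
    have := congrArg (e * ·) hc
    simp only [mul_add, mul_smul_comm] at this
    rw [← this]; abel
  have i3 := congrArg (inner ℝ v) hc
  have i4 := congrArg (inner ℝ v) c4
  simp only [inner_add_right, inner_sub_right, inner_smul_right] at i3 i4
  simp only [← real_inner_self_eq_norm_sq, inner_sub_left, inner_sub_right, inner_smul_left,
    inner_smul_right, hs, RCLike.conj_to_real]
  linarith

lemma inner_idempotent_mul_self_nonneg {e : V} (he : e * e = e) (v : V) :
    0 ≤ inner ℝ (e * v) v := by
  rw [inner_idempotent_mul_self he]; positivity

lemma idempotent_mul_eq_zero {e : V} (he : e * e = e) {v : V} (h : inner ℝ (e * v) v = 0) :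
    e * v = 0 := by
  rw [inner_idempotent_mul_self he] at h
  have h1 : ‖(2 : ℝ) • (e * (e * v)) - e * v‖ ^ 2 = 0 := by
    nlinarith [sq_nonneg ‖(2 : ℝ) • (e * (e * v)) - e * v‖, sq_nonneg ‖e * v - e * (e * v)‖]
  have h2 : ‖e * v - e * (e * v)‖ ^ 2 = 0 := by
    nlinarith [sq_nonneg ‖(2 : ℝ) • (e * (e * v)) - e * v‖, sq_nonneg ‖e * v - e * (e * v)‖]
  simp only [pow_eq_zero_iff two_ne_zero, norm_eq_zero] at h1 h2
  rw [sub_eq_zero] at h1 h2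
  rw [← h2, two_smul] at h1
  simpa using h1

lemma idempotent_mul_sq_eq_zero {e : V} (he : e * e = e) {v : V} (h : e * v = 0) :
    e * (v * v) = 0 := by
  have := linearized_jordan e e v v
  rw [he, mul_comm v e, h] at this
  simpa using this

lemma inner_mul_self (a b : V) : inner ℝ a (b * b) = inner ℝ (a * b) b := by
  rw [real_inner_comm, inner_mul', mul_comm b, real_inner_comm]

theorem inner_nonneg_of_mem {a b : V} (ha : a ∈ symmetricCone V) (hb : b ∈ symmetricCone V) :
    0 ≤ inner ℝ a b := by
  obtain ⟨c, rfl⟩ := ha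
  obtain ⟨d, rfl⟩ := hb
  obtain ⟨S, e, he, hc⟩ := exists_spectral_decomposition c
  rw [hc, he.sum_mul_sum, sum_inner]
  refine Finset.sum_nonneg fun r hr => ?_
  rw [real_inner_smul_left, inner_mul_self]
  exact mul_nonneg (mul_self_nonneg r) (inner_idempotent_mul_self_nonneg (he.idem r hr) d)

theorem mul_eq_zero_of_inner_eq_zero {a b : V} (ha : a ∈ symmetricCone V)
    (hb : b ∈ symmetricCone V) (h : inner ℝ a b = 0) : a * b = 0 := by
  obtain ⟨c, rfl⟩ := ha
  obtain ⟨d, rfl⟩ := hb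
  obtain ⟨S, e, he, hc⟩ := exists_spectral_decomposition c
  rw [hc, he.sum_mul_sum] at h ⊢
  simp only [sum_inner, inner_mul_self, smul_mul', real_inner_smul_left] at h
  rw [Finset.sum_eq_zero_iff_of_nonneg fun r hr =>
    mul_nonneg (mul_self_nonneg r) (inner_idempotent_mul_self_nonneg (he.idem r hr) d)] at h
  rw [Finset.sum_mul]
  refine Finset.sum_eq_zero fun r hr => ?_
  rw [smul_mul_assoc]
  rcases mul_eq_zero.mp (h r hr) with h0 | h0
  · rw [h0, zero_smul]
  · rw [idempotent_mul_sq_eq_zero (he.idem r hr) (idempotent_mul_eq_zero (he.idem r hr) h0),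
      smul_zero]

lemma eq_zero_of_mul_self_eq_zero {a : V} (h : a * a = 0) : a = 0 := by
  have h1 := inner_mul_self 1 a
  rw [one_mul', h, inner_zero_right] at h1
  exact inner_self_eq_zero.mp h1.symm

/-- With d = (a - b)², the hypothesis makes ⟨αa + βb, d⟩ vanish. Both terms are nonnegative, so a ∘
d = b ∘ d = 0, the cube of a - b is zero, and thus ‖d‖² = 0. -/
theorem eq_of_sub_mul_eq_zero {a b : V} (ha : a ∈ symmetricCone V) (hb : b ∈ symmetricCone V)
    {α β : ℝ} (hα : 0 < α) (hβ : 0 < β) (h : (a - b) * (α • a + β • b) = 0) : a = b := by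
  have hd : (a - b) * (a - b) ∈ symmetricCone V := ⟨_, rfl⟩
  have h1 : inner ℝ (α • a + β • b) ((a - b) * (a - b)) = 0 := by
    rw [inner_mul_self, mul_comm, h, inner_zero_left]
  rw [inner_add_left, real_inner_smul_left, real_inner_smul_left] at h1
  have ha0 := inner_nonneg_of_mem ha hd
  have hb0 := inner_nonneg_of_mem hb hd
  have ha1 : inner ℝ a ((a - b) * (a - b)) = 0 := by
    nlinarith [mul_nonneg hα.le ha0, mul_nonneg hβ.le hb0]
  have hb1 : inner ℝ b ((a - b) * (a - b)) = 0 := by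
    nlinarith [mul_nonneg hα.le ha0, mul_nonneg hβ.le hb0]
  have h3 : (a - b) * ((a - b) * (a - b)) = 0 := by
    rw [sub_mul, mul_eq_zero_of_inner_eq_zero ha hd ha1, mul_eq_zero_of_inner_eq_zero hb hd hb1,
      sub_zero]
  have h4 : (a - b) * (a - b) = 0 := by
    rw [← inner_self_eq_zero (𝕜 := ℝ), inner_mul', h3, inner_zero_right]
  exact sub_eq_zero.mp (eq_zero_of_mul_self_eq_zero h4)

theorem eq_of_mul_self_eq {a b : V} (ha : a ∈ symmetricCone V) (hb : b ∈ symmetricCone V)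
    (h : a * a = b * b) : a = b := by
  refine eq_of_sub_mul_eq_zero ha hb one_pos one_pos ?_
  rw [one_smul, one_smul, sub_mul, mul_add, mul_add, h, mul_comm b a]
  abel

/-! ### Self-duality, square roots and projection -/

lemma exists_spectral_decomposition_nonneg {a : V}
    (ha : ∀ b ∈ symmetricCone V, 0 ≤ inner ℝ a b) : ∃ (S : Finset ℝ) (e : ℝ → V),
    IsOrthogonalSystem S e ∧ a = ∑ r ∈ S, max r 0 • e r := by
  obtain ⟨S, e, he, h⟩ := exists_spectral_decomposition a
  refine ⟨S, e, he, h.trans (Finset.sum_congr rfl fun r hr => ?_)⟩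
  rcases le_or_gt 0 r with h0 | h0
  · rw [max_eq_left h0]
  -- Testing `a` against the cone element `e r` gives 0 ≤ r‖e r‖² with r < 0.
  · suffices e r = 0 by simp [this]
    have h1 : a * e r = r • e r := by
      rw [h, Finset.sum_mul, Finset.sum_eq_single_of_mem r hr]
      · rw [smul_mul_assoc, he.idem r hr]
      · intro s hs hsr
        rw [smul_mul_assoc, he.orthogonal s hs r hr hsr, smul_zero]
    have h2 := ha (e r) ⟨e r, (he.idem r hr).symm⟩
    rw [← he.idem r hr, inner_mul_self, h1, real_inner_smul_left, real_inner_self_eq_norm_sq] at h2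
    have : ‖e r‖ ^ 2 = 0 := by nlinarith [sq_nonneg ‖e r‖]
    simpa using this

/-- The symmetric cone is self-dual. -/
theorem mem_symmetricCone_iff {a : V} :
    a ∈ symmetricCone V ↔ ∀ b ∈ symmetricCone V, 0 ≤ inner ℝ a b := by
  refine ⟨fun ha b hb => inner_nonneg_of_mem ha hb, fun ha => ?_⟩
  obtain ⟨S, e, he, rfl⟩ := exists_spectral_decomposition_nonneg ha
  exact he.sum_mem_symmetricCone _ fun r _ => le_max_right r 0

lemma add_mem_symmetricCone {a b : V} (ha : a ∈ symmetricCone V) (hb : b ∈ symmetricCone V) :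
    a + b ∈ symmetricCone V := by
  rw [mem_symmetricCone_iff] at ha hb ⊢
  intro c hc
  rw [inner_add_left]
  exact add_nonneg (ha c hc) (hb c hc)

theorem isConeSqrt_sqrt {a : V} (ha : a ∈ symmetricCone V) : IsConeSqrt a (sqrt a) := by
  refine Classical.epsilon_spec (p := IsConeSqrt a) ?_
  obtain ⟨S, e, he, rfl⟩ := exists_spectral_decomposition_nonneg (mem_symmetricCone_iff.mp ha)
  refine ⟨∑ r ∈ S, √(max r 0) • e r,
    he.sum_mem_symmetricCone _ fun r _ => Real.sqrt_nonneg _, ?_⟩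
  rw [he.sum_mul_sum]
  exact Finset.sum_congr rfl fun r _ => by rw [Real.mul_self_sqrt (le_max_right r 0)]

lemma sqrt_mul_self {a : V} (ha : a ∈ symmetricCone V) : sqrt (a * a) = a :=
  have h := isConeSqrt_sqrt (a := a * a) ⟨a, rfl⟩
  eq_of_mul_self_eq h.1 ha h.2

lemma exists_orthogonal_decomposition (x : V) : ∃ p ∈ symmetricCone V, ∃ q ∈ symmetricCone V,
    x = p - q ∧ p * q = 0 := by
  obtain ⟨S, e, he, h⟩ := exists_spectral_decomposition x
  refine ⟨∑ r ∈ S, max r 0 • e r, he.sum_mem_symmetricCone _ fun r _ => le_max_right r 0,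
    ∑ r ∈ S, max (-r) 0 • e r, he.sum_mem_symmetricCone _ fun r _ => le_max_right (-r) 0, ?_, ?_⟩
  · rw [h, ← Finset.sum_sub_distrib]
    refine Finset.sum_congr rfl fun r _ => ?_
    rw [← sub_smul]
    congr 1
    rcases le_total 0 r with h0 | h0
    · rw [max_eq_left h0, max_eq_right (by linarith), sub_zero]
    · rw [max_eq_right h0, max_eq_left (by linarith)]; ring
  · rw [he.sum_mul_sum]
    refine Finset.sum_eq_zero fun r _ => ?_
    rcases le_total 0 r with h0 | h0
    · rw [max_eq_right (a := -r) (by linarith), mul_zero, zero_smul]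
    · rw [max_eq_right h0, zero_mul, zero_smul]

/-- Moreau decomposition: expanding ‖x - z‖² about p leaves the cross term 2⟨z, q⟩, nonnegative on
the cone. -/
lemma posPart_eq {x p q : V} (hp : p ∈ symmetricCone V) (hq : q ∈ symmetricCone V)
    (hx : x = p - q) (hpq : p * q = 0) : posPart x = p := by
  have hpq' : inner ℝ p q = 0 := by
    have := inner_mul' p 1 q
    rwa [mul_one_right, hpq, inner_zero_right] at this
  have key : ∀ z : V, ‖x - z‖ ^ 2 = ‖p - z‖ ^ 2 + ‖x - p‖ ^ 2 + 2 * inner ℝ z q := by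
    intro z
    have e1 : x - z = (p - z) - q := by rw [hx]; abel
    have e2 : x - p = -q := by rw [hx]; abel
    rw [e1, norm_sub_sq_real, e2, norm_neg, inner_sub_left, hpq']
    ring
  have hproj : IsConeProj x p := by
    refine ⟨hp, fun z hz => ?_⟩
    have := inner_nonneg_of_mem hz hq
    exact (sq_le_sq₀ (norm_nonneg _) (norm_nonneg _)).mp (by nlinarith [key z, sq_nonneg ‖p - z‖])
  have hspec : IsConeProj x (posPart x) := Classical.epsilon_spec ⟨p, hproj⟩
  have h1 := hspec.2 p hp
  have h2 := key (posPart x)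
  have h3 := inner_nonneg_of_mem hspec.1 hq
  have h4 : ‖p - posPart x‖ ^ 2 = 0 := by
    nlinarith [sq_nonneg ‖p - posPart x‖, norm_nonneg (x - posPart x), norm_nonneg (x - p)]
  exact (sub_eq_zero.mp (by simpa using h4)).symm

/-! ### The two implications -/

theorem fischerBurmeister_eq_zero_of_minMap_eq_zero {x y : V} (h : minMap x y = 0) :
    fischerBurmeister x y = 0 := by
  obtain ⟨p, hp, q, hq, hxy, hpq⟩ := exists_orthogonal_decomposition (x - y)
  rw [minMap, posPart_eq hp hq hxy hpq, sub_eq_zero] at h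
  subst h
  obtain rfl : y = q := by simpa using hxy
  have : x * x + y * y = (x + y) * (x + y) := by
    rw [add_mul, mul_add, mul_add, mul_comm y x, hpq]; abel
  rw [fischerBurmeister, this, sqrt_mul_self (add_mem_symmetricCone hp hq), sub_self]

theorem minMap_eq_zero_of_combination_eq_zero {x y : V} {t : ℝ} (ht₀ : 0 ≤ t) (ht₁ : t ≤ 1)
    (h : t • fischerBurmeister x y + (1 - t) • minMap x y = 0) : minMap x y = 0 := by
  obtain ⟨p, hp, q, hq, hxy, hpq⟩ := exists_orthogonal_decomposition (x - y)
  obtain ⟨hA, hA2⟩ := isConeSqrt_sqrt (a := x * x + y * y)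
    (add_mem_symmetricCone ⟨x, rfl⟩ ⟨y, rfl⟩)
  have hB := add_mem_symmetricCone hp hq
  rw [fischerBurmeister] at h
  rw [minMap, posPart_eq hp hq hxy hpq] at h ⊢
  generalize sqrt (x * x + y * y) = A at *
  obtain ⟨B, hBdef⟩ : ∃ B, B = p + q := ⟨_, rfl⟩
  have hy : y = x - p + q := by rw [eq_sub_iff_add_eq] at hxy; rw [← hxy]; abel
  have hsum : (1 + t) • (x + y) = (2 * t) • A + (1 - t) • B := by
    have h2 : (2 : ℝ) • (t • (x + y - A) + (1 - t) • (x - p)) = 0 := by rw [h, smul_zero]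
    rw [← sub_eq_zero, ← h2, hBdef, hy]
    module
  have hBsq : B * B = (x - y) * (x - y) := by
    rw [hxy, hBdef]
    simp only [add_mul, mul_add, sub_mul, mul_sub, mul_comm q p, hpq]
    abel
  have hs : (2 : ℝ) • (A * A) = (x + y) * (x + y) + B * B := by
    rw [hA2, hBsq]
    simp only [add_mul, mul_add, sub_mul, mul_sub, mul_comm y x]
    module
  have hs' : (2 * (1 + t) ^ 2) • (A * A) = ((2 * t) • A + (1 - t) • B) *
      ((2 * t) • A + (1 - t) • B) + ((1 + t) ^ 2) • (B * B) := by
    rw [← hsum, smul_mul_smul_comm, ← pow_two, ← smul_add, ← hs, smul_smul, mul_comm]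
  have hAB : A = B := by
    -- α = 2(1 + t)² - 4t² and β = (1 - t)² + (1 + t)² are the coefficients of A² and -B² in `hs'`;
    -- β - α = -4t(1 - t) matches the coefficient of A ∘ B.
    refine eq_of_sub_mul_eq_zero hA (hBdef ▸ hB) (α := 2 + 4 * t - 2 * t ^ 2)
      (β := 2 + 2 * t ^ 2) (by nlinarith) (by positivity) ?_
    simp only [add_mul, mul_add, sub_mul, smul_mul', mul_smul_comm, mul_comm B A] at hs' ⊢
    rw [← sub_eq_zero] at hs'
    rw [← hs']
    module
  have hsB : (1 + t) • (x + y) = (1 + t) • B := by rw [hsum, hAB]; module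
  have hxyB : x + y = B := smul_right_injective V (by positivity : (1 + t) ≠ 0) hsB
  have h2 : (2 : ℝ) • (x - p) = 0 := by
    rw [← sub_eq_zero] at hxyB
    rw [← hxyB, hBdef, hy]
    module
  exact (smul_eq_zero.mp h2).resolve_left two_ne_zero

end

end EuclideanJordanAlgebra

theorem proposition2 {V : Type*} [NormedAddCommGroup V] [InnerProductSpace ℝ V]
    [FiniteDimensional ℝ V] [EuclideanJordanAlgebra V]
    (x y : V) (t : ℝ) (ht₀ : 0 ≤ t) (ht₁ : t ≤ 1) :
    t • EuclideanJordanAlgebra.fischerBurmeister x y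
        + (1 - t) • EuclideanJordanAlgebra.minMap x y = 0 ↔
      EuclideanJordanAlgebra.minMap x y = 0 := by
  refine ⟨EuclideanJordanAlgebra.minMap_eq_zero_of_combination_eq_zero ht₀ ht₁, fun h => ?_⟩
  rw [EuclideanJordanAlgebra.fischerBurmeister_eq_zero_of_minMap_eq_zero h, h, smul_zero,
    smul_zero, add_zero]
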